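/- For $n\ge 0$ let $\gamma_n$ be the standard Gaussian measure on $\mathbb R^n$, with density $(2\pi)^{-n/2}e^{-\|x\|^2/2}$. For $K\subseteq\mathbb R^n$ with $n\ge 1$, $i\in\{1,\dots,n\}$ and $t\in\mathbb R$, the section $K\cap\{x_i=t\}$ is regarded as a subset of $\mathbb R^{n-1}$ by deleting the $i$-th coordinate. Let $\alpha\ge 0$. (1) There exist constants $\eta,\tau\in(0,1)$, depending only on $\alpha$, such that for every $n\ge 1$ and every convex set $K\subseteq\mathbb R^n$ with $\gamma_n(K)>e^{-\eta n}$ there are a coordinate $i\in\{1,\dots,n\}$ and a sign $\xi\in\{-1,1\}$ with $$\gamma_{n-1}\bigl(K\cap\{x_i=\alpha\xi\}\bigr)\ \ge\ \tau\,\gamma_n(K).$$ (2) Consequently, there exist constants $\varepsilon,\delta\in(0,1)$, depending only on $\alpha$, such that for every $n\ge 0$ every convex set $K\subseteq\mathbb R^n$ with $\gamma_n(K)\ge e^{-\varepsilon n}$ contains a point $x$ with $\#\{i\in\{1,\dots,n\}: |x_i|=\alpha\}\ge\delta n$. -/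

import Mathlib

open MeasureTheory ProbabilityTheory

/-- The standard Gaussian measure `γ_n` on `ℝⁿ`: the product of `n` standard Gaussian
measures on `ℝ`, i.e. the measure with density `(2π)^(-n/2) * exp (-(x₁² + ⋯ + xₙ²) / 2)`. -/
noncomputable def gaussianMeasure (n : ℕ) : Measure (Fin n → ℝ) :=
  Measure.pi fun _ => gaussianReal 0 1

/-- The section `K ∩ {x | x i = t}` of a set `K ⊆ ℝ^(m+1)`, as a subset of `ℝ^m`: the
hyperplane `{x | x i = t}` is identified with `ℝ^m` by deleting the (constant) `i`-th
coordinate. -/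
def coordSection {m : ℕ} (K : Set (Fin (m + 1) → ℝ)) (i : Fin (m + 1)) (t : ℝ) :
    Set (Fin m → ℝ) :=
  i.removeNth '' (K ∩ {x | x i = t})

theorem mem_coordSection {m : ℕ} (K : Set (Fin (m + 1) → ℝ)) (i : Fin (m + 1)) (t : ℝ)
    (y : Fin m → ℝ) :
    y ∈ coordSection K i t ↔ (i.insertNth t y : Fin (m + 1) → ℝ) ∈ K := by
  constructor
  · rintro ⟨x, ⟨hx, hxi⟩, rfl⟩
    have hxi' : x i = t := hxi
    subst hxi'
    simpa using hx
  · intro h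
    exact ⟨i.insertNth t y, ⟨h, by simp⟩, by simp⟩

/-! Fix a height `a`, write κ for the measure of K, and suppose every section at height `a` has
measure below κ/2. By Prékopa–Leindler the section measures in direction i are midpoint log-concave
in t (`gaussianMeasure_coordSection_mul_le`), so of `t` and `2 * a - t` at least one lies in the set
S_i of heights whose section is below κ/2. Hence S_i has one-dimensional Gaussian measure at least
some p > 0 depending only on `a` (`gaussianPDFReal_le_real_of_reflection`).

By Fubini, K gives {x_i ∈ S_i} at most half its expected share. The number of i with x_i ∈ S_i is a
sum of independent indicators under the Gaussian measure, and an exponential moment shows that its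
mean can be halved only on a set of measure at most exp(-pn/8) (`gaussianMeasure_real_le_exp`). This
proves (1), with the sign +1 always available.

For (2), sections are taken repeatedly: each costs one dimension and a factor τ, so a number of
steps proportional to n is affordable (`exists_mem_le_ncard`). -/

open scoped ENNReal

/-! ### Midpoint Prékopa–Leindler for Lebesgue measure on the line -/

open scoped Pointwise in
/-- The one-dimensional Brunn–Minkowski inequality for midpoints of compact sets. -/
theorem volume_add_volume_le_of_isCompact {A B C : Set ℝ} (hA : IsCompact A) (hB : IsCompact B)
    (hA0 : A.Nonempty) (hB0 : B.Nonempty) (hC : ∀ a ∈ A, ∀ b ∈ B, (a + b) / 2 ∈ C) :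
    volume A + volume B ≤ 2 * volume C := by
  obtain ⟨M, hM, hM'⟩ := hA.exists_isGreatest hA0
  obtain ⟨m, hm, hm'⟩ := hB.exists_isLeast hB0
  -- The translates A + min B and B + max A both lie in 2C and meet at most in the point min B + max
  -- A.
  have hsub : (fun x => x + m) '' A ∪ (fun x => x + M) '' B ⊆ (2 : ℝ) • C := by
    rintro _ (⟨a, ha, rfl⟩ | ⟨b, hb, rfl⟩)
    · exact ⟨_, hC a ha m hm, by simp; ring⟩
    · exact ⟨_, hC M hM b hb, by simp; ring⟩
  have hdisj : AEDisjoint volume ((fun x => x + m) '' A) ((fun x => x + M) '' B) := by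
    refine measure_mono_null (t := {m + M}) ?_ (by simp)
    rintro _ ⟨⟨a, ha, rfl⟩, ⟨b, hb, hab⟩⟩
    have h1 := hM' ha
    have h2 := hm' hb
    simp only at hab
    simp only [Set.mem_singleton_iff]
    linarith
  have hmeas : MeasurableSet ((fun x => x + M) '' B) :=
    (hB.image (by fun_prop)).measurableSet
  calc volume A + volume B = volume ((fun x => x + m) '' A) + volume ((fun x => x + M) '' B) := by
        simp
    _ = volume ((fun x => x + m) '' A ∪ (fun x => x + M) '' B) :=
        (measure_union₀ hmeas.nullMeasurableSet hdisj).symm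
    _ ≤ volume ((2 : ℝ) • C) := measure_mono hsub
    _ = 2 * volume C := by simp [Measure.addHaar_smul]

/-- The one-dimensional Brunn–Minkowski inequality for midpoints. -/
theorem volume_add_volume_le {A B C : Set ℝ} (hA : MeasurableSet A) (hB : MeasurableSet B)
    (hA0 : A.Nonempty) (hB0 : B.Nonempty) (hC : ∀ a ∈ A, ∀ b ∈ B, (a + b) / 2 ∈ C) :
    volume A + volume B ≤ 2 * volume C := by
  obtain ⟨a, ha⟩ := hA0
  obtain ⟨b, hb⟩ := hB0
  rw [hA.measure_eq_iSup_isCompact, hB.measure_eq_iSup_isCompact]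
  simp only [iSup_and']
  refine ENNReal.biSup_add_biSup_le' ⟨∅, by simp⟩ ⟨∅, by simp⟩ ?_
  rintro K ⟨hKA, hK⟩ L ⟨hLB, hL⟩
  -- Adjoining `a` and `b` keeps the compact subsets nonempty.
  refine le_trans ?_ (volume_add_volume_le_of_isCompact (hK.insert a) (hL.insert b)
    (Set.insert_nonempty _ _) (Set.insert_nonempty _ _) fun x hx y hy =>
      hC x (Set.insert_subset ha hKA hx) y (Set.insert_subset hb hLB hy))
  gcongr <;> exact Set.subset_insert _ _

theorem ENNReal.four_mul_mul_le_add_sq (a b : ℝ≥0∞) : 4 * (a * b) ≤ (a + b) ^ 2 := by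
  by_cases ha : a = ⊤
  · simp [ha]
  by_cases hb : b = ⊤
  · simp [hb]
  lift a to NNReal using ha
  lift b to NNReal using hb
  norm_cast
  rw [← NNReal.coe_le_coe]
  push_cast
  nlinarith [sq_nonneg ((a : ℝ) - b)]

/-- The Prékopa–Leindler inequality for midpoints on the real line, for functions with
supremum one. -/
theorem lintegral_add_lintegral_le {f g h : ℝ → ℝ} (hf : Measurable f) (hg : Measurable g)
    (hh : Measurable h) (hf0 : ∀ x, 0 ≤ f x) (hg0 : ∀ x, 0 ≤ g x) (hh0 : ∀ x, 0 ≤ h x)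
    (hf1 : IsLUB (Set.range f) 1) (hg1 : IsLUB (Set.range g) 1)
    (hfg : ∀ x y, f x * g y ≤ h ((x + y) / 2) ^ 2) :
    (∫⁻ x, ENNReal.ofReal (f x)) + ∫⁻ x, ENNReal.ofReal (g x) ≤
      2 * ∫⁻ x, ENNReal.ofReal (h x) := by
  rw [lintegral_eq_lintegral_meas_lt volume (.of_forall hf0) hf.aemeasurable,
    lintegral_eq_lintegral_meas_lt volume (.of_forall hg0) hg.aemeasurable,
    lintegral_eq_lintegral_meas_lt volume (.of_forall hh0) hh.aemeasurable,
    ← lintegral_const_mul' _ _ (by simp), ← lintegral_add_left]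
  · refine setLIntegral_mono' measurableSet_Ioi fun t ht => ?_
    have ht : 0 < t := ht
    -- Both suprema being 1, the superlevel sets of f and g at t are both nonempty for t < 1, as
    -- Brunn–Minkowski requires, and both empty for t ≥ 1.
    rcases lt_or_ge t 1 with ht1 | ht1
    · obtain ⟨_, ⟨x, rfl⟩, hx, -⟩ := hf1.exists_between ht1
      obtain ⟨_, ⟨y, rfl⟩, hy, -⟩ := hg1.exists_between ht1
      refine volume_add_volume_le (measurableSet_lt measurable_const hf)
        (measurableSet_lt measurable_const hg) ⟨x, hx⟩ ⟨y, hy⟩ fun a ha b hb => ?_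
      simp only [Set.mem_ofPred_eq] at ha hb ⊢
      refine lt_of_pow_lt_pow_left₀ 2 (hh0 _) (lt_of_lt_of_le ?_ (hfg a b))
      nlinarith
    · have h1 : {a | t < f a} = ∅ := by
        ext a
        simpa using (hf1.1 ⟨a, rfl⟩).trans ht1
      have h2 : {a | t < g a} = ∅ := by
        ext a
        simpa using (hg1.1 ⟨a, rfl⟩).trans ht1
      simp [h1, h2]
  · exact Antitone.measurable fun s t hst => measure_mono fun a ha => lt_of_le_of_lt hst ha

/-- The Prékopa–Leindler inequality for midpoints on the real line. -/
theorem lintegral_mul_lintegral_le {f g h : ℝ → ℝ} (hf : Measurable f) (hg : Measurable g)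
    (hh : Measurable h) (hf0 : ∀ x, 0 ≤ f x) (hg0 : ∀ x, 0 ≤ g x) (hh0 : ∀ x, 0 ≤ h x)
    (hf1 : BddAbove (Set.range f)) (hg1 : BddAbove (Set.range g))
    (hfg : ∀ x y, f x * g y ≤ h ((x + y) / 2) ^ 2) :
    (∫⁻ x, ENNReal.ofReal (f x)) * ∫⁻ x, ENNReal.ofReal (g x) ≤
      (∫⁻ x, ENNReal.ofReal (h x)) ^ 2 := by
  by_cases hfz : ∀ x, f x = 0
  · simp [hfz]
  by_cases hgz : ∀ x, g x = 0
  · simp [hgz]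
  push Not at hfz hgz
  obtain ⟨x₀, hx₀⟩ := hfz
  obtain ⟨y₀, hy₀⟩ := hgz
  set a := sSup (Set.range f) with ha_def
  set b := sSup (Set.range g) with hb_def
  have ha : 0 < a := ((hf0 x₀).lt_of_ne' hx₀).trans_le (le_csSup hf1 ⟨x₀, rfl⟩)
  have hb : 0 < b := ((hg0 y₀).lt_of_ne' hy₀).trans_le (le_csSup hg1 ⟨y₀, rfl⟩)
  have normalize : ∀ {u : ℝ → ℝ}, BddAbove (Set.range u) → 0 < sSup (Set.range u) →
      IsLUB (Set.range fun x => (sSup (Set.range u))⁻¹ * u x) 1 := by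
    intro u hu hpos
    have hl := isLUB_csSup (Set.range_nonempty u) hu
    refine ⟨?_, fun c hc => ?_⟩
    · rintro _ ⟨x, rfl⟩
      have := hl.1 ⟨x, rfl⟩
      simp only
      rw [inv_mul_le_iff₀ hpos]
      simpa using this
    · have : sSup (Set.range u) ≤ sSup (Set.range u) * c := by
        refine hl.2 ?_
        rintro _ ⟨x, rfl⟩
        exact (inv_mul_le_iff₀ hpos).1 (hc ⟨x, rfl⟩)
      exact le_of_mul_le_mul_left (by simpa using this) hpos
  have hs : 0 < √(a * b) := Real.sqrt_pos.2 (mul_pos ha hb)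
  have key := lintegral_add_lintegral_le (f := fun x => a⁻¹ * f x) (g := fun x => b⁻¹ * g x)
    (h := fun x => (√(a * b))⁻¹ * h x) (by fun_prop) (by fun_prop) (by fun_prop)
    (fun x => mul_nonneg (by positivity) (hf0 x)) (fun x => mul_nonneg (by positivity) (hg0 x))
    (fun x => mul_nonneg (by positivity) (hh0 x)) (normalize hf1 ha) (normalize hg1 hb) (by
      intro x y
      rw [mul_pow, inv_pow, Real.sq_sqrt (by positivity)]
      calc a⁻¹ * f x * (b⁻¹ * g y) = (a * b)⁻¹ * (f x * g y) := by
            field_simp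
        _ ≤ _ := by gcongr; exact hfg x y)
  have scale : ∀ {c : ℝ} (u : ℝ → ℝ), 0 ≤ c →
      ∫⁻ x, ENNReal.ofReal (c * u x) = ENNReal.ofReal c * ∫⁻ x, ENNReal.ofReal (u x) := by
    intro c u hc
    simp_rw [ENNReal.ofReal_mul hc]
    exact lintegral_const_mul' _ _ (by simp)
  rw [scale f (by positivity), scale g (by positivity), scale h (by positivity)] at key
  set F := ∫⁻ x, ENNReal.ofReal (f x)
  set G := ∫⁻ x, ENNReal.ofReal (g x)
  set H := ∫⁻ x, ENNReal.ofReal (h x)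
  -- AM–GM turns the additive bound into a product bound; the normalising factor 1/(ab) then
  -- cancels.
  have h4 := (ENNReal.four_mul_mul_le_add_sq _ _).trans (pow_le_pow_left' key 2)
  have e1 : 4 * (ENNReal.ofReal a⁻¹ * F * (ENNReal.ofReal b⁻¹ * G)) =
      (4 * ENNReal.ofReal (a * b)⁻¹) * (F * G) := by
    rw [mul_inv, ENNReal.ofReal_mul (by positivity)]
    ring
  have e2 : (2 * (ENNReal.ofReal (√(a * b))⁻¹ * H)) ^ 2 =
      (4 * ENNReal.ofReal (a * b)⁻¹) * H ^ 2 := by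
    rw [mul_pow, mul_pow, ← ENNReal.ofReal_pow (by positivity), inv_pow,
      Real.sq_sqrt (by positivity)]
    ring
  rw [e1, e2] at h4
  refine (ENNReal.mul_le_mul_iff_right ?_ ?_).1 h4
  · simp
    positivity
  · finiteness

/-! ### Prékopa–Leindler for the Gaussian measure in every dimension -/

theorem gaussianPDFReal_mul_le_sq (x y : ℝ) :
    gaussianPDFReal 0 1 x * gaussianPDFReal 0 1 y ≤ gaussianPDFReal 0 1 ((x + y) / 2) ^ 2 := by
  simp only [gaussianPDFReal, mul_pow]
  rw [mul_mul_mul_comm, ← sq, ← Real.exp_add, ← Real.exp_nat_mul]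
  refine mul_le_mul_of_nonneg_left (Real.exp_le_exp.2 ?_) (by positivity)
  push_cast
  nlinarith [sq_nonneg (x - y)]

theorem gaussianPDFReal_le_one (x : ℝ) : gaussianPDFReal 0 1 x ≤ 1 := by
  simp only [gaussianPDFReal]
  refine mul_le_one₀ (inv_le_one_of_one_le₀ ?_) (Real.exp_nonneg _) ?_
  · rw [Real.one_le_sqrt]
    push_cast
    nlinarith [Real.pi_gt_three]
  · rw [Real.exp_le_one_iff]
    push_cast
    nlinarith [sq_nonneg x]

/-- The Prékopa–Leindler inequality for midpoints and the standard Gaussian on the real line. -/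
theorem lintegral_gaussianReal_mul_le {f g h : ℝ → ℝ≥0∞} (hf : Measurable f) (hg : Measurable g)
    (hh : Measurable h) (hf1 : ∀ x, f x ≤ 1) (hg1 : ∀ x, g x ≤ 1)
    (hfg : ∀ x y, f x * g y ≤ h ((x + y) / 2) ^ 2) :
    (∫⁻ x, f x ∂gaussianReal 0 1) * ∫⁻ x, g x ∂gaussianReal 0 1 ≤
      (∫⁻ x, h x ∂gaussianReal 0 1) ^ 2 := by
  have conv : ∀ {u : ℝ → ℝ≥0∞}, Measurable u → (∀ x, u x ≤ 1) →
      ∫⁻ x, u x ∂gaussianReal 0 1 =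
        ∫⁻ x, ENNReal.ofReal (gaussianPDFReal 0 1 x * (u x).toReal) := by
    intro u hu hu1
    rw [gaussianReal_of_var_ne_zero _ one_ne_zero,
      lintegral_withDensity_eq_lintegral_mul _ (measurable_gaussianPDF 0 1) hu]
    refine lintegral_congr fun x => ?_
    rw [ENNReal.ofReal_mul (gaussianPDFReal_nonneg _ _ _),
      ENNReal.ofReal_toReal (ne_top_of_le_ne_top ENNReal.one_ne_top (hu1 x))]
    rfl
  have bdd : ∀ {u : ℝ → ℝ≥0∞}, (∀ x, u x ≤ 1) →
      BddAbove (Set.range fun x => gaussianPDFReal 0 1 x * (u x).toReal) := by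
    intro u hu1
    refine ⟨1, ?_⟩
    rintro _ ⟨x, rfl⟩
    exact mul_le_one₀ (gaussianPDFReal_le_one x) ENNReal.toReal_nonneg
      (ENNReal.toReal_le_of_le_ofReal zero_le_one (by simpa using hu1 x))
  -- As f, g ≤ 1, truncating h at 1 preserves the hypothesis and makes h finite, so that `toReal`
  -- loses nothing.
  have hh' : Measurable fun x => min (h x) 1 := hh.min measurable_const
  have hfg' : ∀ x y, f x * g y ≤ min (h ((x + y) / 2)) 1 ^ 2 := by
    intro x y
    rcases le_total (h ((x + y) / 2)) 1 with hle | hle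
    · rw [min_eq_left hle]
      exact hfg x y
    · rw [min_eq_right hle, one_pow]
      exact mul_le_one' (hf1 x) (hg1 y)
  have hm := measurable_gaussianPDFReal 0 1
  calc _ ≤ (∫⁻ x, min (h x) 1 ∂gaussianReal 0 1) ^ 2 := by
        rw [conv hf hf1, conv hg hg1, conv hh' fun x => min_le_right _ _]
        refine lintegral_mul_lintegral_le (hm.mul hf.ennreal_toReal) (hm.mul hg.ennreal_toReal)
          (hm.mul hh'.ennreal_toReal)
          (fun x => mul_nonneg (gaussianPDFReal_nonneg _ _ _) ENNReal.toReal_nonneg)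
          (fun x => mul_nonneg (gaussianPDFReal_nonneg _ _ _) ENNReal.toReal_nonneg)
          (fun x => mul_nonneg (gaussianPDFReal_nonneg _ _ _) ENNReal.toReal_nonneg)
          (bdd hf1) (bdd hg1) fun x y => ?_
        rw [mul_pow, mul_mul_mul_comm]
        refine mul_le_mul (gaussianPDFReal_mul_le_sq x y) ?_ (by positivity) (by positivity)
        rw [← ENNReal.toReal_mul, ← ENNReal.toReal_pow]
        refine ENNReal.toReal_mono (ENNReal.pow_ne_top ?_) (hfg' x y)
        exact ne_top_of_le_ne_top ENNReal.one_ne_top (min_le_right _ _)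
    _ ≤ _ := by
        gcongr
        exact min_le_left _ _

instance (n : ℕ) : IsProbabilityMeasure (gaussianMeasure n) := by
  unfold gaussianMeasure
  infer_instance

theorem measurePreserving_insertNth_gaussianMeasure {m : ℕ} (i : Fin (m + 1)) :
    MeasurePreserving (fun p : ℝ × (Fin m → ℝ) => (i.insertNth p.1 p.2 : Fin (m + 1) → ℝ))
      ((gaussianReal 0 1).prod (gaussianMeasure m)) (gaussianMeasure (m + 1)) :=
  (measurePreserving_piFinSuccAbove (fun _ : Fin (m + 1) => gaussianReal 0 1) i).symm

theorem lintegral_gaussianMeasure_succ {m : ℕ} (i : Fin (m + 1)) {f : (Fin (m + 1) → ℝ) → ℝ≥0∞}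
    (hf : Measurable f) :
    ∫⁻ x, f x ∂gaussianMeasure (m + 1) =
      ∫⁻ t, ∫⁻ y, f (i.insertNth t y) ∂gaussianMeasure m ∂gaussianReal 0 1 := by
  have h := measurePreserving_insertNth_gaussianMeasure i
  rw [← h.lintegral_comp hf]
  exact lintegral_prod _ (hf.comp h.measurable).aemeasurable

theorem midpoint_insertNth {m : ℕ} (i : Fin (m + 1)) (s t : ℝ) (x y : Fin m → ℝ) :
    midpoint ℝ (i.insertNth s x : Fin (m + 1) → ℝ) (i.insertNth t y) =
      i.insertNth ((s + t) / 2) (midpoint ℝ x y) := by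
  ext j
  refine Fin.succAboveCases i ?_ (fun j => ?_) j <;>
    simp [midpoint_eq_smul_add] <;> ring

/-- The Prékopa–Leindler inequality for midpoints and the standard Gaussian measure. -/
theorem lintegral_gaussianMeasure_mul_le {n : ℕ} {f g h : (Fin n → ℝ) → ℝ≥0∞}
    (hf : Measurable f) (hg : Measurable g) (hh : Measurable h) (hf1 : ∀ x, f x ≤ 1)
    (hg1 : ∀ x, g x ≤ 1) (hfg : ∀ x y, f x * g y ≤ h (midpoint ℝ x y) ^ 2) :
    (∫⁻ x, f x ∂gaussianMeasure n) * ∫⁻ x, g x ∂gaussianMeasure n ≤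
      (∫⁻ x, h x ∂gaussianMeasure n) ^ 2 := by
  induction n with
  | zero =>
    have e : ∀ u : (Fin 0 → ℝ) → ℝ≥0∞, ∫⁻ x, u x ∂gaussianMeasure 0 = u 0 := fun u => by
      have : u = fun _ => u 0 := funext fun x => congrArg u (Subsingleton.elim _ _)
      rw [this]
      simp
    rw [e, e, e]
    simpa using hfg 0 0
  | succ m ih =>
    have hi := (measurePreserving_insertNth_gaussianMeasure (0 : Fin (m + 1))).measurable
    have le_one : ∀ {u : (Fin (m + 1) → ℝ) → ℝ≥0∞}, (∀ x, u x ≤ 1) → ∀ t : ℝ,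
        ∫⁻ y, u ((0 : Fin (m + 1)).insertNth t y) ∂gaussianMeasure m ≤ 1 := fun hu t =>
      (lintegral_mono fun y => hu _).trans (by simp)
    simp only [lintegral_gaussianMeasure_succ 0 hf, lintegral_gaussianMeasure_succ 0 hg,
      lintegral_gaussianMeasure_succ 0 hh]
    -- The integrals over the remaining coordinates satisfy the one-dimensional hypothesis by
    -- induction.
    refine lintegral_gaussianReal_mul_le (hf.comp hi).lintegral_prod_right'
      (hg.comp hi).lintegral_prod_right' (hh.comp hi).lintegral_prod_right'
      (le_one hf1) (le_one hg1) fun s t => ?_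
    have sec : ∀ r : ℝ, Measurable fun y : Fin m → ℝ =>
        ((0 : Fin (m + 1)).insertNth r y : Fin (m + 1) → ℝ) := fun r =>
      hi.comp measurable_prodMk_left
    refine ih (hf.comp (sec s)) (hg.comp (sec t)) (hh.comp (sec _)) (fun _ => hf1 _)
      (fun _ => hg1 _) fun x y => ?_
    simpa only [midpoint_insertNth] using hfg (Fin.insertNth 0 s x) (Fin.insertNth 0 t y)

theorem gaussianMeasure_mul_le {n : ℕ} {A B C : Set (Fin n → ℝ)} (hA : MeasurableSet A)
    (hB : MeasurableSet B) (hC : MeasurableSet C)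
    (h : ∀ x ∈ A, ∀ y ∈ B, midpoint ℝ x y ∈ C) :
    gaussianMeasure n A * gaussianMeasure n B ≤ gaussianMeasure n C ^ 2 := by
  have key := lintegral_gaussianMeasure_mul_le (n := n) (f := A.indicator 1) (g := B.indicator 1)
    (h := C.indicator 1) (measurable_one.indicator hA) (measurable_one.indicator hB)
    (measurable_one.indicator hC)
    (fun x => Set.indicator_le_self' (by simp) x) (fun x => Set.indicator_le_self' (by simp) x)
    fun x y => by
      by_cases hx : x ∈ A
      · by_cases hy : y ∈ B
        · simp [hx, hy, h x hx y hy]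
        · simp [hy]
      · simp [hx]
  rwa [lintegral_indicator_one hA, lintegral_indicator_one hB, lintegral_indicator_one hC] at key

/-! ### Convex sets and their sections -/

theorem gaussianMeasure_absolutelyContinuous (n : ℕ) : gaussianMeasure n ≪ volume := by
  induction n with
  | zero =>
    rw [gaussianMeasure, volume_pi, Measure.pi_of_empty, Measure.pi_of_empty]
  | succ m ih =>
    have h1 := measurePreserving_insertNth_gaussianMeasure (0 : Fin (m + 1))
    have h2 := (volume_preserving_piFinSuccAbove (fun _ : Fin (m + 1) => ℝ) 0).symm
    rw [← h1.map_eq, ← h2.map_eq]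
    exact ((gaussianReal_absolutelyContinuous 0 one_ne_zero).prod ih).map h1.measurable

/-- A convex set need not be Borel, but its frontier is Lebesgue null; its open interior can replace
it in Fubini arguments. -/
theorem gaussianMeasure_interior {n : ℕ} {K : Set (Fin n → ℝ)} (hK : Convex ℝ K) :
    gaussianMeasure n (interior K) = gaussianMeasure n K :=
  measure_congr (interior_ae_eq_of_null_frontier
    (gaussianMeasure_absolutelyContinuous n (hK.addHaar_frontier volume)))

theorem coordSection_eq_preimage {m : ℕ} (K : Set (Fin (m + 1) → ℝ)) (i : Fin (m + 1)) (t : ℝ) :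
    coordSection K i t = (fun y => (i.insertNth t y : Fin (m + 1) → ℝ)) ⁻¹' K :=
  Set.ext fun y => mem_coordSection K i t y

theorem measurableSet_coordSection {m : ℕ} {K : Set (Fin (m + 1) → ℝ)} (hK : MeasurableSet K)
    (i : Fin (m + 1)) (t : ℝ) : MeasurableSet (coordSection K i t) := by
  rw [coordSection_eq_preimage]
  exact ((measurePreserving_insertNth_gaussianMeasure i).measurable.comp
    measurable_prodMk_left) hK

theorem measurable_gaussianMeasure_coordSection {m : ℕ} {K : Set (Fin (m + 1) → ℝ)}
    (hK : MeasurableSet K) (i : Fin (m + 1)) :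
    Measurable fun t => gaussianMeasure m (coordSection K i t) := by
  simp only [coordSection_eq_preimage]
  exact measurable_measure_prodMk_left
    ((measurePreserving_insertNth_gaussianMeasure i).measurable hK)

theorem convex_coordSection {m : ℕ} {K : Set (Fin (m + 1) → ℝ)} (hK : Convex ℝ K)
    (i : Fin (m + 1)) (t : ℝ) : Convex ℝ (coordSection K i t) := by
  intro x hx y hy a b ha hb hab
  rw [mem_coordSection] at hx hy ⊢
  convert hK hx hy ha hb hab using 1
  ext j
  refine Fin.succAboveCases i ?_ (fun j => ?_) j
  · simp [← add_mul, hab]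
  · simp

/-- Gaussian measures of parallel sections of a convex set are midpoint log-concave. -/
theorem gaussianMeasure_coordSection_mul_le {m : ℕ} {K : Set (Fin (m + 1) → ℝ)}
    (hK : Convex ℝ K) (hKm : MeasurableSet K) (i : Fin (m + 1)) (s t : ℝ) :
    gaussianMeasure m (coordSection K i s) * gaussianMeasure m (coordSection K i t) ≤
      gaussianMeasure m (coordSection K i ((s + t) / 2)) ^ 2 := by
  refine gaussianMeasure_mul_le (measurableSet_coordSection hKm i s)
    (measurableSet_coordSection hKm i t) (measurableSet_coordSection hKm i _) fun x hx y hy => ?_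
  rw [mem_coordSection] at hx hy ⊢
  rw [← midpoint_insertNth]
  exact hK.midpoint_mem hx hy

theorem gaussianMeasure_inter_eval {m : ℕ} {K : Set (Fin (m + 1) → ℝ)} (hK : MeasurableSet K)
    (i : Fin (m + 1)) {S : Set ℝ} (hS : MeasurableSet S) :
    gaussianMeasure (m + 1) (K ∩ {x | x i ∈ S}) =
      ∫⁻ t in S, gaussianMeasure m (coordSection K i t) ∂gaussianReal 0 1 := by
  have hm : MeasurableSet (K ∩ {x | x i ∈ S}) := hK.inter (measurable_pi_apply i hS)
  rw [← lintegral_indicator_one hm,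
    lintegral_gaussianMeasure_succ i (measurable_one.indicator hm), ← lintegral_indicator hS]
  refine lintegral_congr fun t => ?_
  by_cases ht : t ∈ S
  · rw [Set.indicator_of_mem ht, ← lintegral_indicator_one (measurableSet_coordSection hK i t)]
    refine lintegral_congr fun y => ?_
    have hy : i.insertNth t y ∈ K ∩ {x : Fin (m + 1) → ℝ | x i ∈ S} ↔ y ∈ coordSection K i t := by
      rw [mem_coordSection, Set.mem_inter_iff, Set.mem_ofPred_eq, Fin.insertNth_apply_same]
      exact and_iff_left ht
    by_cases hyK : y ∈ coordSection K i t
    · rw [Set.indicator_of_mem hyK, Set.indicator_of_mem (hy.2 hyK), Pi.one_apply, Pi.one_apply]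
    · rw [Set.indicator_of_notMem hyK, Set.indicator_of_notMem (mt hy.1 hyK)]
  · simp [Set.indicator, ht]

/-! ### Reflection and exponential moment estimates -/

theorem gaussianPDFReal_le_gaussianPDFReal {x y : ℝ} (h : |x| ≤ |y|) :
    gaussianPDFReal 0 1 y ≤ gaussianPDFReal 0 1 x := by
  simp only [gaussianPDFReal]
  refine mul_le_mul_of_nonneg_left (Real.exp_le_exp.2 ?_) (by positivity)
  have := sq_le_sq.2 h
  push_cast
  linarith

/-- A set which together with its reflection in `a` covers the line has Gaussian measure bounded
below in terms of `a`. -/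
theorem gaussianPDFReal_le_real_of_reflection {a : ℝ} {S : Set ℝ} (hS : MeasurableSet S)
    (h : ∀ t, t ∈ S ∨ 2 * a - t ∈ S) :
    gaussianPDFReal 0 1 (|a| + 1) ≤ (gaussianReal 0 1).real S := by
  set I := Set.Icc (a - 1) (a + 1)
  have hI : MeasurableSet I := measurableSet_Icc
  -- The interval I of length 2 is symmetric about `a`, so S fills at least half of it; on I the
  -- density is at least its value at `|a| + 1`.
  have hvol : 1 ≤ volume (S ∩ I) := by
    have hsub : I ⊆ (S ∩ I) ∪ (fun t => 2 * a - t) ⁻¹' (S ∩ I) := by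
      intro t ht
      rcases h t with h1 | h1
      · exact .inl ⟨h1, ht⟩
      · refine .inr ⟨h1, ?_, ?_⟩ <;> linarith [ht.1, ht.2]
    have hle := (measure_mono hsub).trans (measure_union_le (μ := volume) _ _)
    rw [(Measure.measurePreserving_sub_left volume (2 * a)).measure_preimage
      (hS.inter hI).nullMeasurableSet, Real.volume_Icc, ← two_mul] at hle
    have h2 : ENNReal.ofReal (a + 1 - (a - 1)) = 2 * 1 := by
      rw [show a + 1 - (a - 1) = 2 by ring]
      simp
    rw [h2] at hle
    exact (ENNReal.mul_le_mul_iff_right (by simp) (by simp)).1 hle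
  refine (ENNReal.ofReal_le_iff_le_toReal (measure_ne_top _ _)).1 ?_
  calc ENNReal.ofReal (gaussianPDFReal 0 1 (|a| + 1))
      ≤ ENNReal.ofReal (gaussianPDFReal 0 1 (|a| + 1)) * volume (S ∩ I) :=
        le_mul_of_one_le_right' hvol
    _ = ∫⁻ _ in S ∩ I, ENNReal.ofReal (gaussianPDFReal 0 1 (|a| + 1)) := by
        rw [setLIntegral_const]
    _ ≤ ∫⁻ x in S ∩ I, gaussianPDF 0 1 x := by
        refine setLIntegral_mono (measurable_gaussianPDF 0 1) fun x hx => ?_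
        refine ENNReal.ofReal_le_ofReal (gaussianPDFReal_le_gaussianPDFReal ?_)
        rw [abs_of_nonneg (by positivity : 0 ≤ |a| + 1), abs_le]
        constructor <;> linarith [hx.2.1, hx.2.2, neg_abs_le a, le_abs_self a]
    _ = gaussianReal 0 1 (S ∩ I) := (gaussianReal_apply 0 one_ne_zero _).symm
    _ ≤ _ := measure_mono Set.inter_subset_left

theorem integral_exp_neg_indicator {μ : Measure ℝ} [IsProbabilityMeasure μ] {S : Set ℝ}
    (hS : MeasurableSet S) :
    ∫ t, Real.exp (-S.indicator 1 t) ∂μ = 1 - (1 - Real.exp (-1)) * μ.real S := by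
  have e : ∀ t, Real.exp (-S.indicator 1 t) = 1 - (1 - Real.exp (-1)) * S.indicator 1 t := by
    intro t
    by_cases ht : t ∈ S <;> simp [ht]
  have hint : Integrable (S.indicator (1 : ℝ → ℝ)) μ := (integrable_const 1).indicator hS
  simp_rw [e]
  rw [integral_sub (integrable_const _) (hint.const_mul _), integral_const_mul,
    integral_indicator_one hS]
  simp

/-- If in each coordinate the set `K` gives to some event at most half of its expected share, then
`K` has exponentially small measure. -/
theorem gaussianMeasure_real_le_exp {n : ℕ} {K : Set (Fin n → ℝ)}
    {S : Fin n → Set ℝ} (hS : ∀ i, MeasurableSet (S i)) {p : ℝ}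
    (hp : ∀ i, p ≤ (gaussianReal 0 1).real (S i))
    (h : ∀ i, (gaussianMeasure n).real (K ∩ {x | x i ∈ S i}) ≤
      1 / 2 * (gaussianMeasure n).real K * (gaussianReal 0 1).real (S i)) :
    (gaussianMeasure n).real K ≤ Real.exp (-(p / 8 * n)) := by
  set μ := gaussianMeasure n with hμ
  set q : Fin n → ℝ := fun i => (gaussianReal 0 1).real (S i)
  set κ := μ.real K with hκ
  set N : (Fin n → ℝ) → ℝ := fun x => ∑ i, (S i).indicator 1 (x i) with hN
  set Q := ∑ i, q i with hQ
  have hind : ∀ i, Measurable fun x : Fin n → ℝ => (S i).indicator (1 : ℝ → ℝ) (x i) := fun i =>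
    (measurable_one.indicator (hS i)).comp (measurable_pi_apply i)
  have hNm : Measurable N := Finset.measurable_sum _ fun i _ => hind i
  have hindint : ∀ i, Integrable (fun x : Fin n → ℝ => (S i).indicator (1 : ℝ → ℝ) (x i)) μ :=
    fun i => Integrable.of_bound (hind i).aestronglyMeasurable 1 (.of_forall fun x => by
      by_cases hx : x i ∈ S i <;> simp [hx])
  have hNint : Integrable N μ := integrable_finsetSum _ fun i _ => hindint i
  have hN0 : ∀ x, 0 ≤ N x := fun x => Finset.sum_nonneg fun i _ =>
    Set.indicator_nonneg (by simp) _
  have heint : Integrable (fun x => Real.exp (-N x)) μ :=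
    Integrable.of_bound hNm.neg.exp.aestronglyMeasurable 1 (.of_forall fun x => by
      simpa using hN0 x)
  have hNK : ∫ x in K, N x ∂μ ≤ Q / 2 * κ := by
    rw [integral_finsetSum _ fun i _ => (hindint i).integrableOn, hQ, Finset.sum_div,
      Finset.sum_mul]
    refine Finset.sum_le_sum fun i _ => ?_
    have hm : MeasurableSet {x : Fin n → ℝ | x i ∈ S i} := measurable_pi_apply i (hS i)
    have e : (fun x : Fin n → ℝ => (S i).indicator (1 : ℝ → ℝ) (x i)) =
        Set.indicator {x : Fin n → ℝ | x i ∈ S i} 1 := by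
      ext x
      simp [Set.indicator]
    rw [e, integral_indicator_one hm, measureReal_restrict_apply hm, Set.inter_comm]
    refine (h i).trans (le_of_eq ?_)
    ring
  -- Jensen's inequality on K, via the tangent line of exp(-N) at N = Q/2.
  have hlow : Real.exp (-(Q / 2)) * κ ≤ ∫ x in K, Real.exp (-N x) ∂μ := by
    have hlin : Integrable (fun x => Real.exp (-(Q / 2)) * (1 + Q / 2 - N x)) (μ.restrict K) :=
      (((integrable_const _).sub hNint).const_mul _).integrableOn
    calc Real.exp (-(Q / 2)) * κ
        ≤ Real.exp (-(Q / 2)) * ((1 + Q / 2) * κ - ∫ x in K, N x ∂μ) := by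
          gcongr
          linarith
      _ = ∫ x in K, Real.exp (-(Q / 2)) * (1 + Q / 2 - N x) ∂μ := by
          rw [integral_const_mul, integral_sub (integrable_const _) hNint.integrableOn]
          simp [hκ, mul_comm]
      _ ≤ ∫ x in K, Real.exp (-N x) ∂μ := by
          refine integral_mono hlin heint.integrableOn fun x => ?_
          have := Real.add_one_le_exp (Q / 2 - N x)
          calc Real.exp (-(Q / 2)) * (1 + Q / 2 - N x)
              ≤ Real.exp (-(Q / 2)) * Real.exp (Q / 2 - N x) := by
                gcongr
                linarith
            _ = Real.exp (-N x) := by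
                rw [← Real.exp_add]
                ring_nf
  have hup : ∫ x in K, Real.exp (-N x) ∂μ ≤ Real.exp (-((1 - Real.exp (-1)) * Q)) := by
    calc ∫ x in K, Real.exp (-N x) ∂μ ≤ ∫ x, Real.exp (-N x) ∂μ :=
          setIntegral_le_integral heint (.of_forall fun x => (Real.exp_pos _).le)
      _ = ∏ i, ∫ t, Real.exp (-(S i).indicator 1 t) ∂gaussianReal 0 1 := by
          rw [hμ, gaussianMeasure, ← integral_fintype_prod_eq_prod]
          simp [hN, ← Finset.sum_neg_distrib, Real.exp_sum]
      _ ≤ ∏ i, Real.exp (-((1 - Real.exp (-1)) * q i)) := by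
          refine Finset.prod_le_prod (fun i _ => integral_nonneg fun t => (Real.exp_pos _).le)
            fun i _ => ?_
          rw [integral_exp_neg_indicator (hS i)]
          exact Real.one_sub_le_exp_neg _
      _ = _ := by
          rw [← Real.exp_sum, hQ, Finset.mul_sum, Finset.sum_neg_distrib]
  have hpQ : p * n ≤ Q := by
    calc p * n = ∑ _i : Fin n, p := by simp [mul_comm]
      _ ≤ Q := Finset.sum_le_sum fun i _ => hp i
  have hQ0 : 0 ≤ Q := Finset.sum_nonneg fun i _ => measureReal_nonneg
  -- The gain is (1 - 1/e) - 1/2 ≥ 1/8, the source of the 8 in the exponent.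
  have hexp : Real.exp (-1) ≤ 3 / 8 := by
    have := Real.exp_neg_one_lt_d9
    linarith
  calc κ = Real.exp (Q / 2) * (Real.exp (-(Q / 2)) * κ) := by
        rw [← mul_assoc, ← Real.exp_add]
        simp
    _ ≤ Real.exp (Q / 2) * Real.exp (-((1 - Real.exp (-1)) * Q)) := by
        gcongr
        exact hlow.trans hup
    _ = Real.exp (Q / 2 - (1 - Real.exp (-1)) * Q) := by
        rw [← Real.exp_add]
        ring_nf
    _ ≤ _ := by
        refine Real.exp_le_exp.2 ?_
        nlinarith

/-! ### Large sections and their iteration -/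

/-- A convex set of not too small Gaussian measure has a large section at height `a`. -/
theorem exists_coordSection_ge (a : ℝ) {m : ℕ} {K : Set (Fin (m + 1) → ℝ)} (hK : Convex ℝ K)
    (h : Real.exp (-(gaussianPDFReal 0 1 (|a| + 1) / 8 * ((m + 1 : ℕ) : ℝ))) <
      (gaussianMeasure (m + 1)).real K) :
    ∃ i : Fin (m + 1), 1 / 2 * (gaussianMeasure (m + 1)).real K ≤
      (gaussianMeasure m).real (coordSection K i a) := by
  by_contra! hlt
  set U := interior K with hU
  have hUm : MeasurableSet U := isOpen_interior.measurableSet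
  have hUK : (gaussianMeasure (m + 1)).real U = (gaussianMeasure (m + 1)).real K := by
    rw [measureReal_def, measureReal_def, gaussianMeasure_interior hK]
  rw [← hUK] at h hlt
  set κ := (gaussianMeasure (m + 1)).real U with hκ
  have hκ0 : 0 < κ := (Real.exp_pos _).trans h
  have hsec : ∀ i, Measurable fun t => (gaussianMeasure m).real (coordSection U i t) := fun i =>
    (measurable_gaussianMeasure_coordSection hUm i).ennreal_toReal
  refine h.not_ge (gaussianMeasure_real_le_exp
    (S := fun i => {t | (gaussianMeasure m).real (coordSection U i t) < 1 / 2 * κ})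
    (fun i => measurableSet_lt (hsec i) measurable_const) (fun i => ?_) fun i => ?_)
  · refine gaussianPDFReal_le_real_of_reflection (measurableSet_lt (hsec i) measurable_const)
      fun t => ?_
    simp only [Set.mem_ofPred_eq]
    -- If neither `t` nor `2 * a - t` were in the set, log-concavity would make the section at their
    -- midpoint `a` at least κ/2.
    by_contra! hge
    have hmul := ENNReal.toReal_mono (by finiteness)
      (gaussianMeasure_coordSection_mul_le hK.interior hUm i t (2 * a - t))
    rw [ENNReal.toReal_mul, ENNReal.toReal_pow, show (t + (2 * a - t)) / 2 = a by ring] at hmul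
    have hmono : (gaussianMeasure m).real (coordSection U i a) ≤
        (gaussianMeasure m).real (coordSection K i a) :=
      measureReal_mono (Set.image_mono (Set.inter_subset_inter_left _ interior_subset))
    have h1 : (gaussianMeasure m).real (coordSection U i a) < 1 / 2 * κ := hmono.trans_lt (hlt i)
    have h2 : (1 / 2 * κ) * (1 / 2 * κ) ≤ (gaussianMeasure m).real (coordSection U i a) ^ 2 :=
      (mul_le_mul hge.1 hge.2 (by positivity) measureReal_nonneg).trans hmul
    have h3 : (0 : ℝ) ≤ (gaussianMeasure m).real (coordSection U i a) := measureReal_nonneg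
    nlinarith
  · rw [measureReal_def, gaussianMeasure_inter_eval hUm i
      (measurableSet_lt (hsec i) measurable_const)]
    refine ENNReal.toReal_le_of_le_ofReal (by positivity) ?_
    rw [ENNReal.ofReal_mul (by positivity), measureReal_def (gaussianReal 0 1),
      ENNReal.ofReal_toReal (measure_ne_top _ _), ← setLIntegral_const]
    refine setLIntegral_mono measurable_const fun t ht => ?_
    exact (ENNReal.le_ofReal_iff_toReal_le (measure_ne_top _ _) (by positivity)).2 (le_of_lt ht)

/-- Iterating over sections produces a point with many prescribed coordinates. -/
theorem exists_mem_le_ncard {a η τ : ℝ} (hτ : 0 < τ)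
    (hsec : ∀ (m : ℕ) (K : Set (Fin (m + 1) → ℝ)), Convex ℝ K →
      Real.exp (-(η * ((m + 1 : ℕ) : ℝ))) < (gaussianMeasure (m + 1)).real K →
      ∃ (i : Fin (m + 1)) (ξ : ℝ), (ξ = 1 ∨ ξ = -1) ∧
        τ * (gaussianMeasure (m + 1)).real K ≤ (gaussianMeasure m).real (coordSection K i (a * ξ)))
    (k : ℕ) : ∀ (n : ℕ) (K : Set (Fin n → ℝ)), Convex ℝ K → k ≤ n →
      0 < (gaussianMeasure n).real K →
      (∀ j < k, Real.exp (-(η * ((n : ℝ) - j))) < τ ^ j * (gaussianMeasure n).real K) →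
      ∃ x ∈ K, k ≤ Set.ncard {i : Fin n | |x i| = |a|} := by
  induction k with
  | zero =>
    intro n K _ _ hpos _
    obtain ⟨x, hx⟩ : K.Nonempty := by
      rw [Set.nonempty_iff_ne_empty]
      rintro rfl
      simp at hpos
    exact ⟨x, hx, Nat.zero_le _⟩
  | succ k ih =>
    intro n K hK hkn hpos hj
    obtain ⟨m, rfl⟩ : ∃ m, n = m + 1 := ⟨n - 1, by omega⟩
    obtain ⟨i, ξ, hξ, hle⟩ := hsec m K hK (by simpa using hj 0 k.succ_pos)
    obtain ⟨y, hy, hky⟩ := ih m (coordSection K i (a * ξ)) (convex_coordSection hK i _) (by omega)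
      ((mul_pos hτ hpos).trans_le hle) fun j hjk => by
        -- The bound for K at j + 1 yields the one for its section at j, as m - j = (m + 1) - (j +
        -- 1).
        have := hj (j + 1) (by omega)
        push_cast at this
        rw [show (m : ℝ) + 1 - (j + 1) = m - j by ring] at this
        calc _ < _ := this
          _ = τ ^ j * (τ * (gaussianMeasure (m + 1)).real K) := by ring
          _ ≤ _ := by gcongr
    refine ⟨i.insertNth (a * ξ) y, (mem_coordSection _ _ _ _).1 hy, ?_⟩
    have hsub : insert i (i.succAbove '' {j | |y j| = |a|}) ⊆
        {l | |(i.insertNth (a * ξ) y : Fin (m + 1) → ℝ) l| = |a|} := by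
      refine Set.insert_subset ?_ ?_
      · rcases hξ with rfl | rfl <;> simp
      · rintro _ ⟨j, hj, rfl⟩
        simpa using hj
    refine le_trans ?_ (Set.ncard_le_ncard hsub)
    rw [Set.ncard_insert_of_notMem (by simp [Fin.succAbove_ne]),
      Set.ncard_image_of_injective _ Fin.succAbove_right_injective]
    omega

theorem mainTheorem3 (α : ℝ) (hα : 0 ≤ α) :
    (∃ η ∈ Set.Ioo (0 : ℝ) 1, ∃ τ ∈ Set.Ioo (0 : ℝ) 1,
      ∀ (m : ℕ) (K : Set (Fin (m + 1) → ℝ)), Convex ℝ K →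
        Real.exp (-(η * ((m + 1 : ℕ) : ℝ))) < (gaussianMeasure (m + 1)).real K →
        ∃ (i : Fin (m + 1)) (ξ : ℝ), (ξ = 1 ∨ ξ = -1) ∧
          τ * (gaussianMeasure (m + 1)).real K ≤
            (gaussianMeasure m).real (coordSection K i (α * ξ))) ∧
    (∃ ε ∈ Set.Ioo (0 : ℝ) 1, ∃ δ ∈ Set.Ioo (0 : ℝ) 1,
      ∀ (n : ℕ) (K : Set (Fin n → ℝ)), Convex ℝ K →
        Real.exp (-(ε * (n : ℝ))) ≤ (gaussianMeasure n).real K →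
        ∃ x ∈ K, δ * (n : ℝ) ≤ (Set.ncard {i : Fin n | |x i| = α} : ℝ)) := by
  set η : ℝ := gaussianPDFReal 0 1 (|α| + 1) / 8 with hη
  have hη0 : 0 < η := div_pos (gaussianPDFReal_pos 0 1 _ one_ne_zero) (by norm_num)
  have hη1 : η < 1 := by
    have := gaussianPDFReal_le_one (|α| + 1)
    rw [hη]
    linarith
  have hsec : ∀ (m : ℕ) (K : Set (Fin (m + 1) → ℝ)), Convex ℝ K →
      Real.exp (-(η * ((m + 1 : ℕ) : ℝ))) < (gaussianMeasure (m + 1)).real K →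
      ∃ (i : Fin (m + 1)) (ξ : ℝ), (ξ = 1 ∨ ξ = -1) ∧
        1 / 2 * (gaussianMeasure (m + 1)).real K ≤
          (gaussianMeasure m).real (coordSection K i (α * ξ)) := by
    intro m K hK h
    obtain ⟨i, hi⟩ := exists_coordSection_ge α hK h
    exact ⟨i, 1, .inl rfl, by simpa using hi⟩
  -- With j < ηn/4 and 1/2 ≥ 1/e, the iteration needs j + ηn/4 < η(n - j), which holds because η <
  -- 1.
  refine ⟨⟨η, ⟨hη0, hη1⟩, 1 / 2, by norm_num, hsec⟩,
    η / 4, ⟨by positivity, by linarith⟩, η / 4, ⟨by positivity, by linarith⟩, ?_⟩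
  intro n K hK hle
  have hpos : 0 < (gaussianMeasure n).real K := (Real.exp_pos _).trans_le hle
  have hn : (0 : ℝ) ≤ n := n.cast_nonneg
  obtain ⟨x, hx, hcard⟩ := exists_mem_le_ncard (a := α) (by norm_num) hsec ⌈η / 4 * n⌉₊ n K hK
    (Nat.ceil_le.2 (by nlinarith)) hpos fun j hj => by
      have hj' : (j : ℝ) < η / 4 * n := Nat.lt_ceil.1 hj
      have hhalf : Real.exp (-1) ≤ 1 / 2 := by
        have := Real.exp_neg_one_lt_d9
        linarith
      calc Real.exp (-(η * ((n : ℝ) - j))) < Real.exp (j * (-1) + -(η / 4 * n)) := by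
            refine Real.exp_lt_exp.2 ?_
            have hj0 : (0 : ℝ) ≤ j := j.cast_nonneg
            nlinarith
        _ = Real.exp (-1) ^ j * Real.exp (-(η / 4 * n)) := by
            rw [Real.exp_add, Real.exp_nat_mul]
        _ ≤ (1 / 2) ^ j * (gaussianMeasure n).real K := by gcongr
  rw [abs_of_nonneg hα] at hcard
  exact ⟨x, hx, Nat.ceil_le.1 hcard⟩
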